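/- Let $(\Omega,\mathcal F,\mathbb P)$ be a probability space, let $X=(X_t)_{t\in[0,+\infty)}$ be a real-valued process such that $(t,\omega)\mapsto X_t(\omega)$ is jointly measurable and almost all trajectories are càdlàg, let $\beta>0$ and let $C\ge 0$ be a constant. For $x:[0,+\infty)\to\mathbb R$, $c>0$ and $t\ge 0$ let $$\mathrm{TV}^c(x,[0,t])=\sup\sum_{i=1}^{n}\max\left(|x_{u_i}-x_{u_{i-1}}|-c,\,0\right),$$ the supremum being over all finite partitions $0=u_0\le u_1\le\dots\le u_n=t$. For $y\in\mathbb R$ let $\sigma_0=0$ and, for $n\ge 0$, $\rho_n=\inf\{u\in[\sigma_n,t]: x_u\ge y+c/2\}$, $\sigma_{n+1}=\inf\{u\in[\rho_n,t]: x_u<y-c/2\}$ (with $\inf\emptyset=+\infty$ and $[+\infty,t]=\emptyset$); let $\mathrm d^{y,c}(x,[0,t])=\max\{n:\sigma_n\le t\}$ be the number of downcrossings, $\mathrm u^{y,c}(x,[0,t])=\mathrm d^{-y,c}(-x,[0,t])$ the number of upcrossings, and $\mathrm n^{y,c}=\mathrm u^{y,c}+\mathrm d^{y,c}$ the number of crossings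 of $[y-c/2,y+c/2]$ by $x$ on $[0,t]$. For $\omega\in\Omega$ let $\mu_t(\omega)$ be the occupation measure, $\mu_t(\omega)(\Gamma)=\mathrm{Leb}\{s\in[0,t]: X_s(\omega)\in\Gamma\}$ for Borel $\Gamma\subset\mathbb R$. Assume that for each $t\ge 0$, almost surely, $c^{1/\beta-1}\,\mathrm{TV}^c(X,[0,t])\to C\cdot t$ as $c\to0+$, and that $X$ possesses a local time relative to the Lebesgue measures on $\mathbb R$ and on $[0,+\infty)$, that is, for each $t\ge 0$, almost surely, $\mu_t$ is absolutely continuous with respect to the Lebesgue measure $dy$ on $\mathbb R$. Then there exists a measurable set $\Omega_X\subset\Omega$ with $\mathbb P(\Omega_X)=1$ such that for each $\omega\in\Omega_X$ and each $t\in[0,+\infty)$: $\mu_t(\omega)$ is absolutely continuous with respect to $dy$, so that the local time $L_t^y(\omega)=\frac{d\mu_t(\omega)}{dy}(y)$ is defined; for every $c>0$ the function $y\mapsto \mathrm n^{y,c}(X(\omega),[0,t])$ is Borel measurable; and the measures $c^{1/\beta-1}\,\mathrm n^{y,c}(X(\omega),[0,t])\,dy$, which are finite for all sufficiently small $c>0$,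 converge weakly to the finite measure $C\cdot L_t^y(\omega)\,dy$ as $c\to0+$. -/

import Mathlib

open MeasureTheory Filter Topology Set
open scoped NNReal ENNReal BoundedContinuousFunction

noncomputable section

/-- A real path on `[0, +∞)` is càdlàg: it is right-continuous at each `t ≥ 0` and has a (finite)
left limit at each `t > 0`. -/
def IsCadlag (x : ℝ≥0 → ℝ) : Prop :=
  (∀ t : ℝ≥0, ContinuousWithinAt x (Ici t) t) ∧
    ∀ t : ℝ≥0, 0 < t → ∃ l : ℝ, Tendsto x (𝓝[<] t) (𝓝 l)

/-- The truncated variation `TV^c(x, [s, t])`, as an extended non-negative number: the supremum of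
`∑ (|x (u (i+1)) - x (u i)| - c)₊` over all finite partitions `s = u 0 ≤ u 1 ≤ ⋯ ≤ u n = t`.
`ENNReal.ofReal` is the positive part; for `c ≥ 0` degenerate intervals contribute nothing. -/
def truncatedVariation (c : ℝ) (x : ℝ≥0 → ℝ) (s t : ℝ≥0) : ℝ≥0∞ :=
  ⨆ (n : ℕ) (u : ℕ → ℝ≥0) (_ : Monotone u ∧ u 0 = s ∧ u n = t),
    ∑ i ∈ Finset.range n, ENNReal.ofReal (|x (u (i + 1)) - x (u i)| - c)

/-- `inf {u ∈ [σ, t] : x u ≥ a}`, with value `+∞` if there is no such `u`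
(in particular if `σ = +∞`). -/
def firstGE (x : ℝ≥0 → ℝ) (t : ℝ≥0) (a : ℝ) (σ : ℝ≥0∞) : ℝ≥0∞ :=
  sInf ((fun u : ℝ≥0 => (u : ℝ≥0∞)) '' {u : ℝ≥0 | σ ≤ u ∧ u ≤ t ∧ a ≤ x u})

/-- `inf {u ∈ [ρ, t] : x u < b}`, with value `+∞` if there is no such `u`
(in particular if `ρ = +∞`). -/
def firstLT (x : ℝ≥0 → ℝ) (t : ℝ≥0) (b : ℝ) (ρ : ℝ≥0∞) : ℝ≥0∞ :=
  sInf ((fun u : ℝ≥0 => (u : ℝ≥0∞)) '' {u : ℝ≥0 | ρ ≤ u ∧ u ≤ t ∧ x u < b})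

/-- The times `σ_n^c`: `σ_0^c = s`, `ρ_n^c = inf {u ∈ [σ_n^c, t] : x u ≥ y + c/2}` and
`σ_{n+1}^c = inf {u ∈ [ρ_n^c, t] : x u < y - c/2}`. -/
def crossingTime (y c : ℝ) (x : ℝ≥0 → ℝ) (s t : ℝ≥0) : ℕ → ℝ≥0∞
  | 0 => (s : ℝ≥0∞)
  | n + 1 => firstLT x t (y - c / 2) (firstGE x t (y + c / 2) (crossingTime y c x s t n))

/-- The number of downcrossings `d^{y,c}(x, [s, t]) = max {n : σ_n^c ≤ t}`
(`+∞` if there is no maximum). -/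
def numDowncrossings (y c : ℝ) (x : ℝ≥0 → ℝ) (s t : ℝ≥0) : ℝ≥0∞ :=
  ⨆ (n : ℕ) (_ : crossingTime y c x s t n ≤ t), (n : ℝ≥0∞)

/-- The number of upcrossings `u^{y,c}(x, [s, t]) = d^{-y,c}(-x, [s, t])`. -/
def numUpcrossings (y c : ℝ) (x : ℝ≥0 → ℝ) (s t : ℝ≥0) : ℝ≥0∞ :=
  numDowncrossings (-y) c (fun u => -x u) s t

/-- The number of crossings `n^{y,c}(x, [s, t])` of the interval `[y - c/2, y + c/2]`. -/
def numCrossings (y c : ℝ) (x : ℝ≥0 → ℝ) (s t : ℝ≥0) : ℝ≥0∞ :=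
  numUpcrossings y c x s t + numDowncrossings y c x s t

/-- The Lebesgue measure on `[0, +∞)`. -/
def lebesgueNonneg : Measure ℝ≥0 := (volume : Measure ℝ).comap (fun u : ℝ≥0 => (u : ℝ))

/-- The occupation measure `μ_t(Γ) = ξ {s ∈ [0, t] : x s ∈ Γ}` of a measurable path `x`. -/
def occupationMeasure {E : Type*} [MeasurableSpace E] (x : ℝ≥0 → E) (ξ : Measure ℝ≥0)
    (t : ℝ≥0) : Measure E :=
  (ξ.restrict (Icc 0 t)).map x

/-- The local time `L_t^y = (dμ_t / dν)(y)` of a path `x` relative to `ν` and `ξ`. -/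
def localTime {E : Type*} [MeasurableSpace E] (x : ℝ≥0 → E) (ν : Measure E) (ξ : Measure ℝ≥0)
    (t : ℝ≥0) : E → ℝ≥0∞ :=
  (occupationMeasure x ξ t).rnDeriv ν

/-- The process `X` possesses a local time relative to the measure `ν` and the mapping `Ξ`:
it is jointly measurable and, for each `t`, almost surely `μ_t ≪ ν`. -/
def PossessesLocalTime {Ω E : Type*} [MeasurableSpace Ω] [MeasurableSpace E] (P : Measure Ω)
    (X : ℝ≥0 → Ω → E) (ν : Measure E) (Ξ : Ω → Measure ℝ≥0) : Prop :=
  Measurable (Function.uncurry X) ∧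
    ∀ t : ℝ≥0, ∀ᵐ ω ∂P, occupationMeasure (fun s => X s ω) (Ξ ω) t ≪ ν

/-- Weak convergence along a filter of measures on `ℝ` that are (eventually) finite, to a finite
measure: convergence of the integrals of all bounded continuous functions. -/
def TendstoWeakly {ι : Type*} (μ : ι → Measure ℝ) (l : Filter ι) (ν : Measure ℝ) : Prop :=
  (∀ᶠ i in l, IsFiniteMeasure (μ i)) ∧ IsFiniteMeasure ν ∧
    ∀ g : ℝ →ᵇ ℝ, Tendsto (fun i => ∫ y, g y ∂(μ i)) l (𝓝 (∫ y, g y ∂ν))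

end

/-! Fix a path. The core is the sandwich `TV^c ≤ ∫ n^{y,c} dy ≤ TV^c + c/2`. On the left
(`truncatedVariation_le_lintegral`), an increment of size `d` crosses a set of levels of length `(d
- c)₊`, and crossing counts are superadditive in time. On the right (`lintegral_numCrossings_le`),
the path is sampled on a grid and replaced by its play path, which stays within `c/2` of it and has
variation at most `TV^c + c/2`. A crossing of the band around `y` forces the play path across `y`,
and Fatou's lemma removes the grid. After normalization the total masses tend to `C t`.

For the distribution of this mass, cut `[0, t]` into cells. The levels crossed during a cell lie in
the convex hull of the values taken there, so for continuous `f ≥ 0` the integral of `f` against the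
crossing counts dominates a sum of cell infima of `f` times truncated variations of cells, each
asymptotic to `C` times the cell length. Refining the grid gives the lower bound `C ∫ f (x s) ds`
(`mul_lintegral_le_liminf`). Applied to both `f` and `K - f`, and with the mass converging, it
yields weak convergence to `C` times the occupation measure (`tendstoWeakly_of_le_liminf`); absolute
continuity turns this limit into a density.

Monotonicity in time of the truncated variation and of the occupation measure reduces the
exceptional set to countably many times. -/

/-- There is a chain `s ≤ u 1 ≤ v 1 ≤ u 2 ≤ ⋯ ≤ v n ≤ t` with `p (u i)` and `q (v i)`. -/
inductive AlternatingChain {ι : Type*} [Preorder ι] (p q : ι → Prop) : ℕ → ι → ι → Prop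
  | zero {s t : ι} : s ≤ t → AlternatingChain p q 0 s t
  | succ {n : ℕ} {s r u v t : ι} : AlternatingChain p q n s r → r ≤ u → p u → u ≤ v → q v →
      v ≤ t → AlternatingChain p q (n + 1) s t

namespace AlternatingChain

variable {ι : Type*} [Preorder ι] {p q : ι → Prop}

lemma le {n : ℕ} {s t : ι} (h : AlternatingChain p q n s t) : s ≤ t := by
  induction h with
  | zero h => exact h
  | succ _ h1 _ h2 _ h3 ih => exact ih.trans (h1.trans (h2.trans h3))

lemma mono_right {n : ℕ} {s t t' : ι} (h : AlternatingChain p q n s t) (ht : t ≤ t') :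
    AlternatingChain p q n s t' := by
  cases h with
  | zero h => exact .zero (h.trans ht)
  | succ h h1 hp h2 hq h3 => exact .succ h h1 hp h2 hq (h3.trans ht)

lemma append {m n : ℕ} {s r t : ι} (h : AlternatingChain p q m s r)
    (h' : AlternatingChain p q n r t) : AlternatingChain p q (m + n) s t := by
  induction h' with
  | zero h1 => exact h.mono_right h1
  | succ _ h1 hp h2 hq h3 ih => exact .succ (ih h) h1 hp h2 hq h3

lemma imp {p' q' : ι → Prop} (hp : ∀ i, p i → p' i) (hq : ∀ i, q i → q' i) {n : ℕ} {s t : ι}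
    (h : AlternatingChain p q n s t) : AlternatingChain p' q' n s t := by
  induction h with
  | zero h => exact .zero h
  | succ _ h1 hu h2 hv h3 ih => exact .succ ih h1 (hp _ hu) h2 (hq _ hv) h3

lemma exists_of_ne_zero {n : ℕ} {s t : ι} (h : AlternatingChain p q n s t) (hn : n ≠ 0) :
    ∃ u v, s ≤ u ∧ u ≤ v ∧ v ≤ t ∧ p u ∧ q v := by
  cases h with
  | zero h => exact absurd rfl hn
  | succ h h1 hp h2 hq h3 => exact ⟨_, _, h.le.trans h1, h2, h3, hp, hq⟩

/-- A chain survives a monotone change of times and a change of the predicates along a filter. -/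
lemma eventually_map {α κ : Type*} [Preorder κ] {l : Filter α} {P Q : α → κ → Prop}
    {f : α → ι → κ} (hf : ∀ a, Monotone (f a))
    {n : ℕ} {s t : ι} (hP : ∀ i ≤ t, p i → ∀ᶠ a in l, P a (f a i))
    (hQ : ∀ i ≤ t, q i → ∀ᶠ a in l, Q a (f a i)) (h : AlternatingChain p q n s t) :
    ∀ᶠ a in l, AlternatingChain (P a) (Q a) n (f a s) (f a t) := by
  induction h with
  | zero h => exact Eventually.of_forall fun a => .zero (hf a h)
  | succ h h1 hu h2 hv h3 ih =>
    filter_upwards [ih (fun i hi => hP i (hi.trans (h1.trans (h2.trans h3))))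
      (fun i hi => hQ i (hi.trans (h1.trans (h2.trans h3)))), hP _ (h2.trans h3) hu, hQ _ h3 hv]
      with a ha hPa hQa
    exact .succ ha (hf a h1) hPa (hf a h2) hQa (hf a h3)

end AlternatingChain

/-- The infimum need not be attained. If `E` avoids a right neighbourhood of `v`, however, an
infimum at most `v` can only come from points strictly before `v`. -/
lemma exists_lt_mem_of_sInf_coe_le {E : Set ℝ≥0} {v : ℝ≥0}
    (hle : sInf ((fun u : ℝ≥0 => (u : ℝ≥0∞)) '' E) ≤ v) (hE : Eᶜ ∈ 𝓝[≥] v) :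
    ∃ u ∈ E, u < v := by
  by_contra! hcon
  obtain ⟨w, hw, hwE⟩ := (mem_nhdsGE_iff_exists_Ico_subset).1 hE
  have : (w : ℝ≥0∞) ≤ sInf ((fun u : ℝ≥0 => (u : ℝ≥0∞)) '' E) := by
    refine le_sInf ?_
    rintro _ ⟨u, hu, rfl⟩
    simp only [ENNReal.coe_le_coe]
    by_contra! h
    exact hwE ⟨hcon u hu, h⟩ hu
  exact absurd (ENNReal.coe_le_coe.1 (this.trans hle)) (not_le.2 hw)

/-! ### Crossing numbers as maximal lengths of alternating chains -/

section Crossings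

variable {x : ℝ≥0 → ℝ} {y c : ℝ} {s t : ℝ≥0}

lemma crossingTime_le_of_chain {n : ℕ} {r : ℝ≥0}
    (h : AlternatingChain (fun u => y + c / 2 ≤ x u) (fun v => x v < y - c / 2) n s r)
    (hr : r ≤ t) : crossingTime y c x s t n ≤ r := by
  induction h with
  | zero h => simpa [crossingTime] using h
  | @succ n s r u v t' h h1 hu h2 hv h3 ih =>
    have h4 : crossingTime y c x s t n ≤ r := ih (h1.trans (h2.trans (h3.trans hr)))
    have h5 : firstGE x t (y + c / 2) (crossingTime y c x s t n) ≤ u :=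
      sInf_le ⟨u, ⟨h4.trans (by exact_mod_cast h1), h2.trans (h3.trans hr), hu⟩, rfl⟩
    refine le_trans (sInf_le ⟨v, ⟨h5.trans (by exact_mod_cast h2), h3.trans hr, hv⟩, rfl⟩) ?_
    exact ENNReal.coe_le_coe.2 h3

lemma chain_of_crossingTime_le (hx : ∀ u, ContinuousWithinAt x (Ici u) u) (hc : 0 < c) (n : ℕ)
    (h : crossingTime y c x s t n ≤ t) :
    AlternatingChain (fun u => y + c / 2 ≤ x u) (fun v => x v < y - c / 2) n s t := by
  -- At a time `v` below the band, right-continuity keeps the path under the upper edge just after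
  -- `v`, so an actual point of the upper set precedes `v`; `key` uses the same argument with the
  -- edges exchanged. Here `c > 0` separates the edges.
  have step : ∀ n : ℕ, (∀ u : ℝ≥0, crossingTime y c x s t n ≤ u → u ≤ t → y + c / 2 ≤ x u →
      AlternatingChain (fun u => y + c / 2 ≤ x u) (fun v => x v < y - c / 2) n s u) →
      ∀ v : ℝ≥0, firstGE x t (y + c / 2) (crossingTime y c x s t n) ≤ v → v ≤ t →
        x v < y - c / 2 →
      AlternatingChain (fun u => y + c / 2 ≤ x u) (fun v => x v < y - c / 2) (n + 1) s v := by
    intro n hn v hv hvt hxv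
    obtain ⟨u, ⟨h1, h2, h3⟩, h4⟩ := exists_lt_mem_of_sInf_coe_le hv (by
      filter_upwards [(hx v).eventually_lt_const (show x v < y + c / 2 by linarith)] with u hu
      simp only [mem_compl_iff, mem_ofPred_eq, not_and]
      exact fun _ _ => not_le.2 hu)
    exact .succ (hn u h1 h2 h3) le_rfl h3 h4.le hxv le_rfl
  have key : ∀ n : ℕ, ∀ u : ℝ≥0, crossingTime y c x s t n ≤ u → u ≤ t → y + c / 2 ≤ x u →
      AlternatingChain (fun u => y + c / 2 ≤ x u) (fun v => x v < y - c / 2) n s u := by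
    intro n
    induction n with
    | zero => exact fun u hu _ _ => .zero (by simpa [crossingTime] using hu)
    | succ n ih =>
      intro u hu hut hxu
      obtain ⟨v, ⟨h1, h2, h3⟩, h4⟩ := exists_lt_mem_of_sInf_coe_le hu (by
        filter_upwards [(hx u).eventually_const_lt (show y - c / 2 < x u by linarith)] with v hv
        simp only [mem_compl_iff, mem_ofPred_eq, not_and]
        exact fun _ _ => not_lt.2 hv.le)
      exact (step n ih v h1 h2 h3).mono_right h4.le
  cases n with
  | zero => exact .zero (by simpa [crossingTime] using h)
  | succ n =>
    have h' : firstLT x t (y - c / 2) (firstGE x t (y + c / 2) (crossingTime y c x s t n)) < ⊤ :=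
      lt_of_le_of_lt h ENNReal.coe_lt_top
    obtain ⟨_, ⟨v, ⟨h1, h2, h3⟩, rfl⟩, -⟩ := sInf_lt_iff.1 h'
    exact (step n (key n) v h1 h2 h3).mono_right h2

/-- The greedy count of downcrossings is the greatest length of an alternating chain. -/
lemma crossingTime_le_iff (hx : ∀ u, ContinuousWithinAt x (Ici u) u) (hc : 0 < c) (n : ℕ) :
    crossingTime y c x s t n ≤ t ↔
      AlternatingChain (fun u => y + c / 2 ≤ x u) (fun v => x v < y - c / 2) n s t :=
  ⟨chain_of_crossingTime_le hx hc n, fun h => crossingTime_le_of_chain h le_rfl⟩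

lemma numDowncrossings_eq (hx : ∀ u, ContinuousWithinAt x (Ici u) u) (hc : 0 < c) :
    numDowncrossings y c x s t = ⨆ (n : ℕ) (_ : AlternatingChain (fun u => y + c / 2 ≤ x u)
      (fun v => x v < y - c / 2) n s t), (n : ℝ≥0∞) := by
  simp only [numDowncrossings, crossingTime_le_iff hx hc]

/-- Chains on the two pieces concatenate. Only an inequality holds, since a crossing may straddle
`r`. -/
lemma numDowncrossings_add_le {r : ℝ≥0} (hx : ∀ u, ContinuousWithinAt x (Ici u) u) (hc : 0 < c)
    (hsr : s ≤ r) (hrt : r ≤ t) :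
    numDowncrossings y c x s r + numDowncrossings y c x r t ≤ numDowncrossings y c x s t := by
  simp only [numDowncrossings_eq hx hc]
  refine ENNReal.biSup_add_biSup_le' ⟨0, .zero hsr⟩ ⟨0, .zero hrt⟩ fun m hm n hn => ?_
  rw [← Nat.cast_add]
  exact le_iSup₂_of_le (m + n) (hm.append hn) le_rfl

lemma numCrossings_add_le {r : ℝ≥0} (hx : ∀ u, ContinuousWithinAt x (Ici u) u) (hc : 0 < c)
    (hsr : s ≤ r) (hrt : r ≤ t) :
    numCrossings y c x s r + numCrossings y c x r t ≤ numCrossings y c x s t := by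
  simp only [numCrossings, numUpcrossings]
  rw [add_add_add_comm]
  exact add_le_add (numDowncrossings_add_le (fun u => (hx u).neg) hc hsr hrt)
    (numDowncrossings_add_le hx hc hsr hrt)

lemma sum_numCrossings_le (hx : ∀ u, ContinuousWithinAt x (Ici u) u) (hc : 0 < c) {u : ℕ → ℝ≥0}
    (hu : Monotone u) (n : ℕ) :
    ∑ i ∈ Finset.range n, numCrossings y c x (u i) (u (i + 1)) ≤
      numCrossings y c x (u 0) (u n) := by
  induction n with
  | zero => simp
  | succ n ih =>
    rw [Finset.sum_range_succ]
    exact (add_le_add_left ih _).trans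
      (numCrossings_add_le hx hc (hu (Nat.zero_le n)) (hu n.le_succ))

lemma exists_of_numDowncrossings_ne_zero (hx : ∀ u, ContinuousWithinAt x (Ici u) u) (hc : 0 < c)
    (h : numDowncrossings y c x s t ≠ 0) :
    ∃ u ∈ Icc s t, ∃ v ∈ Icc s t, y + c / 2 ≤ x u ∧ x v < y - c / 2 := by
  by_contra! hcon
  apply h
  rw [numDowncrossings_eq hx hc]
  simp only [ENNReal.iSup_eq_zero, Nat.cast_eq_zero]
  intro n hn
  by_contra hn0
  obtain ⟨u, v, h1, h2, h3, h4, h5⟩ := hn.exists_of_ne_zero hn0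
  exact absurd h5 (not_lt.2 (hcon u ⟨h1, h2.trans h3⟩ v ⟨h1.trans h2, h3⟩ h4))

/-- This localizes the crossed levels in the convex hull of the range, which is what `cellInf` is
designed for. -/
lemma exists_of_numCrossings_ne_zero (hx : ∀ u, ContinuousWithinAt x (Ici u) u) (hc : 0 < c)
    (h : numCrossings y c x s t ≠ 0) :
    ∃ u ∈ Icc s t, ∃ v ∈ Icc s t, x u ≤ y ∧ y ≤ x v := by
  by_cases h0 : numDowncrossings y c x s t = 0
  · have h1 : numDowncrossings (-y) c (fun u => -x u) s t ≠ 0 := by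
      simpa [numCrossings, numUpcrossings, h0] using h
    obtain ⟨u, hu, v, hv, h2, h3⟩ :=
      exists_of_numDowncrossings_ne_zero (fun u => (hx u).neg) hc h1
    simp only [Pi.neg_apply] at h2 h3
    exact ⟨u, hu, v, hv, by linarith, by linarith⟩
  · obtain ⟨u, hu, v, hv, h2, h3⟩ := exists_of_numDowncrossings_ne_zero hx hc h0
    exact ⟨v, hv, u, hu, by linarith, by linarith⟩

lemma one_le_numDowncrossings (hx : ∀ u, ContinuousWithinAt x (Ici u) u) (hc : 0 < c)
    (hst : s ≤ t) (hs : y + c / 2 ≤ x s) (ht : x t < y - c / 2) :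
    1 ≤ numDowncrossings y c x s t := by
  rw [numDowncrossings_eq hx hc]
  exact le_iSup₂_of_le 1 (.succ (.zero le_rfl) le_rfl hs hst ht le_rfl) (by simp)

end Crossings

/-! ### Measurability in the level, and strict versus weak chains -/

section Measurability

variable {x : ℝ≥0 → ℝ} {c : ℝ} {s t : ℝ≥0}

lemma isOpen_strictChain (n : ℕ) :
    IsOpen {y : ℝ | AlternatingChain (fun u => y + c / 2 < x u) (fun v => x v < y - c / 2) n s t} := by
  rw [isOpen_iff_eventually]
  intro y hy
  refine AlternatingChain.eventually_map (f := fun _ => id) (fun _ => monotone_id) ?_ ?_ hy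
  · intro i _ hi
    exact (continuous_id.add continuous_const).continuousAt.eventually_lt_const hi
  · intro i _ hi
    exact (continuous_id.sub continuous_const).continuousAt.eventually_const_lt hi

/-- Lowering the level slightly makes the weak inequalities strict and preserves the open ones.
Every point of the difference is thus isolated from the left in it, and such points are countable.
-/
lemma countable_chain_diff_strictChain (n : ℕ) :
    ({y : ℝ | AlternatingChain (fun u => y + c / 2 ≤ x u) (fun v => x v < y - c / 2) n s t} \
      {y : ℝ | AlternatingChain (fun u => y + c / 2 < x u)
        (fun v => x v < y - c / 2) n s t}).Countable := by
  refine (countable_setOfPred_isolated_left_within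
    (s := {y : ℝ | AlternatingChain (fun u => y + c / 2 ≤ x u) (fun v => x v < y - c / 2) n s t} \
      {y : ℝ | AlternatingChain (fun u => y + c / 2 < x u)
        (fun v => x v < y - c / 2) n s t})).mono ?_
  intro y hy
  refine ⟨hy, ?_⟩
  have : ∀ᶠ y' in 𝓝[<] y,
      AlternatingChain (fun u => y' + c / 2 < x u) (fun v => x v < y' - c / 2) n s t := by
    refine AlternatingChain.eventually_map (f := fun _ => id) (fun _ => monotone_id) ?_ ?_ hy.1
    · intro i _ hi
      filter_upwards [self_mem_nhdsWithin] with y' hy'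
      have : y' < y := hy'
      simp only [id]
      linarith
    · intro i _ hi
      exact ((continuous_id.sub continuous_const).continuousAt.eventually_const_lt hi).filter_mono
        nhdsWithin_le_nhds
  rw [← Filter.empty_mem_iff_bot, inter_comm, nhdsWithin_inter']
  filter_upwards [mem_inf_of_left this, mem_inf_of_right (mem_principal_self _)] with z hz hz'
  exact hz'.2 hz

lemma measurableSet_chain (n : ℕ) :
    MeasurableSet {y : ℝ | AlternatingChain (fun u => y + c / 2 ≤ x u)
      (fun v => x v < y - c / 2) n s t} := by
  rw [← sdiff_union_of_subset (s := {y : ℝ | AlternatingChain (fun u => y + c / 2 ≤ x u)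
      (fun v => x v < y - c / 2) n s t}) (t := {y : ℝ | AlternatingChain (fun u => y + c / 2 < x u)
        (fun v => x v < y - c / 2) n s t}) fun y hy => hy.imp (fun _ h => h.le) fun _ h => h]
  exact (countable_chain_diff_strictChain n).measurableSet.union (isOpen_strictChain n).measurableSet

lemma measurable_numDowncrossings (hx : ∀ u, ContinuousWithinAt x (Ici u) u) (hc : 0 < c) :
    Measurable fun y => numDowncrossings y c x s t := by
  simp only [numDowncrossings_eq hx hc]
  refine Measurable.iSup fun n => ?_
  have : (fun y : ℝ => ⨆ (_ : AlternatingChain (fun u => y + c / 2 ≤ x u)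
      (fun v => x v < y - c / 2) n s t), (n : ℝ≥0∞)) =
      indicator {y : ℝ | AlternatingChain (fun u => y + c / 2 ≤ x u)
      (fun v => x v < y - c / 2) n s t} fun _ => (n : ℝ≥0∞) := by
    ext y
    by_cases hy : AlternatingChain (fun u => y + c / 2 ≤ x u) (fun v => x v < y - c / 2) n s t <;>
      simp [indicator, hy]
  rw [this]
  exact measurable_const.indicator (measurableSet_chain n)

lemma measurable_numCrossings (hx : ∀ u, ContinuousWithinAt x (Ici u) u) (hc : 0 < c) :
    Measurable fun y => numCrossings y c x s t :=
  ((measurable_numDowncrossings (fun u => (hx u).neg) hc).comp measurable_neg).add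
    (measurable_numDowncrossings hx hc)

/-- For almost every level, weak chains can be replaced by strict ones. -/
lemma ae_strictChain : ∀ᵐ y : ℝ, ∀ n : ℕ,
    AlternatingChain (fun u => y + c / 2 ≤ x u) (fun v => x v < y - c / 2) n s t →
    AlternatingChain (fun u => y + c / 2 < x u) (fun v => x v < y - c / 2) n s t := by
  rw [ae_all_iff]
  intro n
  filter_upwards [(countable_chain_diff_strictChain (x := x) (c := c) (s := s) (t := t)
    n).ae_notMem volume] with y hy h
  by_contra h'
  exact hy ⟨h, h'⟩

end Measurability

/-! ### Truncated variation: additivity up to `c`, and the lower half of the sandwich -/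

section TruncatedVariation

variable {x : ℝ≥0 → ℝ} {c : ℝ} {r s t : ℝ≥0}

lemma sum_le_truncatedVariation {u : ℕ → ℝ≥0} (hu : Monotone u) {n : ℕ} (h0 : u 0 = s)
    (hn : u n = t) :
    ∑ i ∈ Finset.range n, ENNReal.ofReal (|x (u (i + 1)) - x (u i)| - c) ≤
      truncatedVariation c x s t :=
  le_iSup_of_le n (le_iSup₂_of_le u ⟨hu, h0, hn⟩ le_rfl)

lemma truncatedVariation_add_le (hrs : r ≤ s) (hst : s ≤ t) :
    truncatedVariation c x r s + ENNReal.ofReal (|x t - x s| - c) ≤ truncatedVariation c x r t := by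
  have key : ∀ (n : ℕ) (u : ℕ → ℝ≥0), (Monotone u ∧ u 0 = r ∧ u n = s) →
      ∑ i ∈ Finset.range n, ENNReal.ofReal (|x (u (i + 1)) - x (u i)| - c) +
        ENNReal.ofReal (|x t - x s| - c) ≤ truncatedVariation c x r t := by
    rintro n u ⟨hu, h0, hn⟩
    have hv : Monotone fun i => if i ≤ n then u i else t := by
      intro i j hij
      dsimp only
      split_ifs with h1 h2
      · exact hu hij
      · exact (hu h1).trans (hn.le.trans hst)
      · omega
      · exact le_rfl
    refine le_trans (le_of_eq ?_) (sum_le_truncatedVariation (n := n + 1) hv (by simpa) (by simp))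
    rw [Finset.sum_range_succ]
    congr 1
    · refine Finset.sum_congr rfl fun i hi => ?_
      rw [Finset.mem_range] at hi
      simp [hi.le, Nat.succ_le_of_lt hi]
    · simp [hn]
  -- Needed so that the truncated subtraction on `ℝ≥0∞` below can be undone.
  have h2 : ENNReal.ofReal (|x t - x s| - c) ≤ truncatedVariation c x r t := by
    refine le_trans le_add_self (key 1 (fun i => if i = 0 then r else s) ⟨?_, by simp, by simp⟩)
    intro i j hij
    dsimp only
    split_ifs with h1 h2
    · exact le_rfl
    · exact hrs
    · omega
    · exact le_rfl
  rw [← tsub_add_cancel_of_le h2]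
  gcongr
  exact iSup_le fun n => iSup₂_le fun u hu =>
    ENNReal.le_sub_of_add_le_right ENNReal.ofReal_ne_top (key n u hu)

lemma truncatedVariation_mono (hrs : r ≤ s) (hst : s ≤ t) :
    truncatedVariation c x r s ≤ truncatedVariation c x r t :=
  le_self_add.trans (truncatedVariation_add_le hrs hst)

/-- Cutting the interval at a point lowers the truncated variation by at most `c`. -/
lemma truncatedVariation_le_add (hc : 0 ≤ c) (hrs : r ≤ s) (hst : s ≤ t) :
    truncatedVariation c x r t ≤
      truncatedVariation c x r s + truncatedVariation c x s t + ENNReal.ofReal c := by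
  refine iSup_le fun n => iSup₂_le ?_
  rintro u ⟨hu, h0, hn⟩
  -- The partition is clipped to either side of `s` by `min` and `max`. Only the step straddling `s`
  -- costs an extra `c`; the last term records whether it has occurred.
  have key : ∀ m : ℕ, ∑ i ∈ Finset.range m, ENNReal.ofReal (|x (u (i + 1)) - x (u i)| - c) ≤
      ∑ i ∈ Finset.range m, ENNReal.ofReal (|x (min (u (i + 1)) s) - x (min (u i) s)| - c) +
      ∑ i ∈ Finset.range m, ENNReal.ofReal (|x (max (u (i + 1)) s) - x (max (u i) s)| - c) +
      (if u m ≤ s then 0 else ENNReal.ofReal c) := by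
    intro m
    induction m with
    | zero => simp
    | succ m ih =>
      simp only [Finset.sum_range_succ]
      have hm : u m ≤ u (m + 1) := hu m.le_succ
      by_cases h1 : u (m + 1) ≤ s
      · rw [if_pos (hm.trans h1)] at ih
        rw [if_pos h1, min_eq_left h1, min_eq_left (hm.trans h1), max_eq_right h1,
          max_eq_right (hm.trans h1), sub_self, abs_zero, zero_sub,
          ENNReal.ofReal_of_nonpos (neg_nonpos.2 hc)]
        simp only [add_zero] at ih ⊢
        rw [add_right_comm]
        gcongr
      · by_cases h2 : u m ≤ s
        · rw [if_pos h2] at ih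
          rw [if_neg h1, min_eq_right (not_le.1 h1).le, min_eq_left h2,
            max_eq_left (not_le.1 h1).le, max_eq_right h2]
          have h3 : ENNReal.ofReal (|x (u (m + 1)) - x (u m)| - c) ≤
              ENNReal.ofReal (|x s - x (u m)| - c) + ENNReal.ofReal (|x (u (m + 1)) - x s| - c) +
                ENNReal.ofReal c := by
            refine le_trans (ENNReal.ofReal_le_ofReal ?_) (ENNReal.ofReal_add_le.trans
              (add_le_add_left ENNReal.ofReal_add_le _))
            linarith [abs_sub_le (x (u (m + 1))) (x s) (x (u m))]
          refine (add_le_add ih h3).trans (le_of_eq ?_)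
          ring
        · have h3 := (not_le.1 h1).le
          have h4 := (not_le.1 h2).le
          rw [if_neg h2] at ih
          rw [if_neg h1, min_eq_right h3, min_eq_right h4, max_eq_left h3, max_eq_left h4, sub_self,
            abs_zero, zero_sub, ENNReal.ofReal_of_nonpos (neg_nonpos.2 hc), add_zero]
          refine (add_le_add_left ih _).trans (le_of_eq ?_)
          ring
  refine (key n).trans ?_
  gcongr
  · exact sum_le_truncatedVariation (u := fun i => min (u i) s)
      (fun i j hij => min_le_min_right s (hu hij)) (by simp [h0, hrs]) (by simp [hn, hst])
  · exact sum_le_truncatedVariation (u := fun i => max (u i) s)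
      (fun i j hij => max_le_max_right s (hu hij)) (by simp [h0, hrs]) (by simp [hn, hst])
  · split_ifs <;> simp

/-- The truncated variation is at most the integral of the numbers of crossings. -/
lemma truncatedVariation_le_lintegral (hx : ∀ u, ContinuousWithinAt x (Ici u) u) (hc : 0 < c) :
    truncatedVariation c x s t ≤ ∫⁻ y, numCrossings y c x s t := by
  have step : ∀ {a b : ℝ≥0}, a ≤ b →
      ENNReal.ofReal (|x b - x a| - c) ≤ ∫⁻ y, numCrossings y c x a b := by
    intro a b hab
    -- Used with the interval between the two values shrunk by `c/2` at each end: its levels are all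
    -- crossed, and its length is the increment minus `c`.
    have h1 : ∀ α γ : ℝ, (∀ y ∈ Ioo α γ, 1 ≤ numCrossings y c x a b) →
        ENNReal.ofReal (γ - α) ≤ ∫⁻ y, numCrossings y c x a b := by
      intro α γ h
      rw [← Real.volume_Ioo, ← lintegral_indicator_one measurableSet_Ioo]
      refine lintegral_mono fun y => ?_
      by_cases hy : y ∈ Ioo α γ <;> simp [hy, h]
    rcases le_total (x a) (x b) with h | h
    · rw [abs_of_nonneg (by linarith)]
      refine le_trans (ENNReal.ofReal_le_ofReal ?_) (h1 (x a + c / 2) (x b - c / 2) ?_)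
      · linarith
      · rintro y ⟨hy1, hy2⟩
        refine le_trans ?_ le_self_add
        exact one_le_numDowncrossings (fun u => (hx u).neg) hc hab
          (by linarith) (by linarith)
    · rw [abs_of_nonpos (by linarith)]
      refine le_trans (ENNReal.ofReal_le_ofReal ?_) (h1 (x b + c / 2) (x a - c / 2) ?_)
      · linarith
      · rintro y ⟨hy1, hy2⟩
        refine le_trans ?_ le_add_self
        exact one_le_numDowncrossings hx hc hab (by linarith) (by linarith)
  refine iSup_le fun n => iSup₂_le ?_
  rintro u ⟨hu, rfl, rfl⟩
  calc ∑ i ∈ Finset.range n, ENNReal.ofReal (|x (u (i + 1)) - x (u i)| - c)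
      ≤ ∑ i ∈ Finset.range n, ∫⁻ y, numCrossings y c x (u i) (u (i + 1)) :=
        Finset.sum_le_sum fun i _ => step (hu i.le_succ)
    _ = ∫⁻ y, ∑ i ∈ Finset.range n, numCrossings y c x (u i) (u (i + 1)) :=
        (lintegral_finsetSum _ fun i _ => measurable_numCrossings hx hc).symm
    _ ≤ _ := lintegral_mono fun y => sum_numCrossings_le hx hc hu n

end TruncatedVariation

/-! ### The play operator and its variation -/

section Play

/-- The play (hysteresis) operator: `playPath c x` moves as little as possible while staying within
distance `c / 2` of `x`. -/
noncomputable def playPath (c : ℝ) (x : ℕ → ℝ) : ℕ → ℝ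
  | 0 => x 0
  | n + 1 => max (x (n + 1) - c / 2) (min (playPath c x n) (x (n + 1) + c / 2))

variable {c : ℝ} {x : ℕ → ℝ}

lemma abs_playPath_sub_le (hc : 0 < c) (n : ℕ) : |playPath c x n - x n| ≤ c / 2 := by
  cases n with
  | zero => simp [playPath]; linarith
  | succ n =>
    rw [abs_le, playPath]
    constructor
    · linarith [le_max_left (x (n + 1) - c / 2) (min (playPath c x n) (x (n + 1) + c / 2))]
    · have : max (x (n + 1) - c / 2) (min (playPath c x n) (x (n + 1) + c / 2)) ≤
        x (n + 1) + c / 2 := max_le (by linarith) (min_le_right _ _)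
      linarith

/-- The variation of the play path is controlled by every functional of the time that increases by
at least the truncated increments of the path. -/
lemma sum_abs_playPath_le (hc : 0 < c) {T : ℕ → ℝ} (h0 : 0 ≤ T 0) (hT : Monotone T)
    (hx : ∀ i j, i ≤ j → T i + (|x j - x i| - c) ≤ T j) (n : ℕ) :
    ∑ i ∈ Finset.range n, |playPath c x (i + 1) - playPath c x i| ≤ T n + c / 2 := by
  -- Three states: not yet moved, last pushed up, last pushed down. Here `j` is the last push and
  -- `i` the previous turning point (or `0`). A reversal at `j` costs a full `c`, absorbed by the
  -- truncated increment from `i` to `j`; the first push starts mid-band and costs only `c/2`, hence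
  -- the surplus.
  have key : ∀ n : ℕ, (playPath c x n = x 0 ∧
        ∑ i ∈ Finset.range n, |playPath c x (i + 1) - playPath c x i| ≤ 0) ∨
      (∃ i j, i ≤ j ∧ j ≤ n ∧ playPath c x n = x j - c / 2 ∧
        ∑ i ∈ Finset.range n, |playPath c x (i + 1) - playPath c x i| ≤
          T i + (x j - x i - c) + c / 2) ∨
      (∃ i j, i ≤ j ∧ j ≤ n ∧ playPath c x n = x j + c / 2 ∧
        ∑ i ∈ Finset.range n, |playPath c x (i + 1) - playPath c x i| ≤
          T i + (x i - x j - c) + c / 2) := by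
    intro n
    induction n with
    | zero => left; simp [playPath]
    | succ n ih =>
      simp only [Finset.sum_range_succ]
      have hz : (playPath c x (n + 1) = playPath c x n) ∨
          (playPath c x (n + 1) = x (n + 1) - c / 2 ∧ playPath c x n < playPath c x (n + 1)) ∨
          (playPath c x (n + 1) = x (n + 1) + c / 2 ∧ playPath c x (n + 1) < playPath c x n) := by
        rw [playPath]
        rcases lt_or_ge (playPath c x n) (x (n + 1) - c / 2) with h | h
        · right; left
          rw [min_eq_left (by linarith), max_eq_left h.le]
          exact ⟨rfl, h⟩
        · rcases lt_or_ge (x (n + 1) + c / 2) (playPath c x n) with h' | h'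
          · right; right
            rw [min_eq_right h'.le, max_eq_right (by linarith)]
            exact ⟨rfl, h'⟩
          · left
            rw [min_eq_left h', max_eq_right h]
      rcases hz with hz | ⟨hz, hlt⟩ | ⟨hz, hlt⟩
      · rw [hz, sub_self, abs_zero, add_zero]
        rcases ih with h | ⟨i, j, hij, hjn, h⟩ | ⟨i, j, hij, hjn, h⟩
        · exact Or.inl h
        · exact Or.inr (Or.inl ⟨i, j, hij, hjn.trans n.le_succ, h⟩)
        · exact Or.inr (Or.inr ⟨i, j, hij, hjn.trans n.le_succ, h⟩)
      · rw [abs_of_pos (sub_pos.2 hlt)]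
        right; left
        rcases ih with ⟨h1, h2⟩ | ⟨i, j, hij, hjn, h1, h2⟩ | ⟨i, j, hij, hjn, h1, h2⟩
        · exact ⟨0, n + 1, Nat.zero_le _, le_rfl, hz, by linarith⟩
        · exact ⟨i, n + 1, by omega, le_rfl, hz, by linarith⟩
        · exact ⟨j, n + 1, by omega, le_rfl, hz, by
            linarith [hx i j hij, neg_le_abs (x j - x i)]⟩
      · rw [abs_of_neg (sub_neg.2 hlt)]
        right; right
        rcases ih with ⟨h1, h2⟩ | ⟨i, j, hij, hjn, h1, h2⟩ | ⟨i, j, hij, hjn, h1, h2⟩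
        · exact ⟨0, n + 1, Nat.zero_le _, le_rfl, hz, by linarith⟩
        · exact ⟨j, n + 1, by omega, le_rfl, hz, by
            linarith [hx i j hij, le_abs_self (x j - x i)]⟩
        · exact ⟨i, n + 1, by omega, le_rfl, hz, by linarith⟩
  rcases key n with ⟨-, h⟩ | ⟨i, j, hij, hjn, -, h⟩ | ⟨i, j, hij, hjn, -, h⟩
  · linarith [hT (Nat.zero_le n)]
  · linarith [hT hjn, hx i j hij, le_abs_self (x j - x i)]
  · linarith [hT hjn, hx i j hij, neg_le_abs (x j - x i)]

open Classical in
/-- The length of an alternating chain is at most the number of exits from `P`. -/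
lemma AlternatingChain.length_le_sum {p q P : ℕ → Prop} (hp : ∀ i, p i → P i)
    (hq : ∀ i, q i → ¬ P i) {n i j : ℕ} (h : AlternatingChain p q n i j) :
    (n : ℝ≥0∞) ≤ ∑ l ∈ Finset.Ico i j, if P l ∧ ¬ P (l + 1) then 1 else 0 := by
  induction h with
  | zero h => simp
  | @succ n s r u v t h h1 hu h2 hv h3 ih =>
    -- `P` holds at `u` and fails at `v`, so it is left in between; distinct links of the chain use
    -- disjoint index ranges.
    have hex : ∃ l ∈ Finset.Ico u v, P l ∧ ¬ P (l + 1) := by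
      by_contra! hcon
      have : ∀ l, u ≤ l → l ≤ v → P l := by
        intro l hl
        induction l, hl using Nat.le_induction with
        | base => exact fun _ => hp _ hu
        | succ l hl ih' =>
          intro hlv
          exact hcon l (Finset.mem_Ico.2 ⟨hl, hlv⟩) (ih' (Nat.le_of_succ_le hlv))
      exact hq _ hv (this v h2 le_rfl)
    obtain ⟨l, hl, hl'⟩ := hex
    push_cast
    calc (n : ℝ≥0∞) + 1 ≤ (∑ l ∈ Finset.Ico s r, if P l ∧ ¬ P (l + 1) then 1 else 0) +
          ∑ l ∈ Finset.Ico u v, if P l ∧ ¬ P (l + 1) then 1 else 0 := by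
          refine add_le_add ih ?_
          refine le_trans ?_ (Finset.single_le_sum (fun _ _ => zero_le) hl)
          simp [hl']
      _ = ∑ l ∈ Finset.Ico s r ∪ Finset.Ico u v, if P l ∧ ¬ P (l + 1) then 1 else 0 := by
          rw [Finset.sum_union]
          rw [Finset.disjoint_left]
          intro a ha hb
          simp only [Finset.mem_Ico] at ha hb
          omega
      _ ≤ _ := by
          refine Finset.sum_le_sum_of_subset ?_
          intro a ha
          have := h.le
          simp only [Finset.mem_union, Finset.mem_Ico] at ha ⊢
          omega

end Play

/-! ### Time grids -/

section Grid

/-- The grid of mesh `1 / (k + 1)` on `[0, t]`. -/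
noncomputable def timeGrid (t : ℝ≥0) (k i : ℕ) : ℝ≥0 := min (i / (k + 1)) t

variable {t : ℝ≥0}

lemma timeGrid_mono (k : ℕ) : Monotone (timeGrid t k) := by
  intro i j hij
  refine min_le_min_right t ?_
  gcongr

lemma timeGrid_zero (k : ℕ) : timeGrid t k 0 = 0 := by simp [timeGrid]

lemma le_timeGrid_ceil {s : ℝ≥0} (hs : s ≤ t) (k : ℕ) : s ≤ timeGrid t k ⌈s * (k + 1)⌉₊ :=
  le_min ((le_div_iff₀ (by positivity)).2 (Nat.le_ceil _)) hs

lemma timeGrid_ceil_self (k : ℕ) : timeGrid t k ⌈t * (k + 1)⌉₊ = t :=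
  le_antisymm (min_le_right _ _) (le_timeGrid_ceil le_rfl k)

/-- Rounding up approaches `s` from the right, so right-continuity of the path suffices. -/
lemma tendsto_timeGrid_ceil {s : ℝ≥0} (hs : s ≤ t) :
    Tendsto (fun k : ℕ => timeGrid t k ⌈s * (k + 1)⌉₊) atTop (𝓝[≥] s) := by
  refine tendsto_nhdsWithin_iff.2 ⟨?_, Eventually.of_forall fun k => le_timeGrid_ceil hs k⟩
  have h : Tendsto (fun k : ℕ => s + 1 / ((k : ℝ≥0) + 1)) atTop (𝓝 (s + 0)) :=
    tendsto_const_nhds.add tendsto_one_div_add_atTop_nhds_zero_nat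
  rw [add_zero] at h
  refine tendsto_of_tendsto_of_tendsto_of_le_of_le tendsto_const_nhds h
    (fun k => le_timeGrid_ceil hs k) fun k => (min_le_left _ _).trans ?_
  have h1 : (⌈s * ((k : ℝ≥0) + 1)⌉₊ : ℝ≥0) ≤ s * (k + 1) + 1 := (Nat.ceil_lt_add_one zero_le).le
  calc (⌈s * ((k : ℝ≥0) + 1)⌉₊ : ℝ≥0) / (k + 1) ≤ (s * (k + 1) + 1) / (k + 1) := by gcongr
    _ = s + 1 / (k + 1) := by rw [add_div, mul_div_cancel_right₀ _ (by positivity)]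

end Grid

/-! ### Upper half of the sandwich -/

section UpperBound

variable {x : ℝ≥0 → ℝ} {c : ℝ} {t : ℝ≥0}

/-- The number of steps of the play path on the grid that cross the level `y`. -/
noncomputable def gridCrossings (c : ℝ) (x : ℝ≥0 → ℝ) (t : ℝ≥0) (k : ℕ) (y : ℝ) : ℝ≥0∞ :=
  ∑ l ∈ Finset.range ⌈t * (k + 1)⌉₊,
    ((Ico (playPath c (fun i => x (timeGrid t k i)) l)
        (playPath c (fun i => x (timeGrid t k i)) (l + 1))).indicator 1 y +
      (Ioc (playPath c (fun i => x (timeGrid t k i)) (l + 1))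
        (playPath c (fun i => x (timeGrid t k i)) l)).indicator 1 y)

lemma measurable_gridCrossings (k : ℕ) : Measurable (gridCrossings c x t k) := by
  unfold gridCrossings
  refine Finset.measurable_fun_sum _ fun l _ => ?_
  exact (measurable_one.indicator measurableSet_Ico).add
    (measurable_one.indicator measurableSet_Ioc)

/-- Integrating over levels the number of steps that cross them gives the variation of the play
path, as in Banach's indicatrix formula. -/
lemma lintegral_gridCrossings_le (hc : 0 < c) (k : ℕ) :
    ∫⁻ y, gridCrossings c x t k y ≤ truncatedVariation c x 0 t + ENNReal.ofReal (c / 2) := by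
  by_cases htop : truncatedVariation c x 0 t = ⊤
  · simp [htop]
  set z := playPath c (fun i => x (timeGrid t k i)) with hz
  have hle : ∀ i, timeGrid t k i ≤ t := fun i => min_le_right _ _
  have hfin : ∀ i, truncatedVariation c x 0 (timeGrid t k i) ≠ ⊤ := fun i =>
    ne_top_of_le_ne_top htop (truncatedVariation_mono zero_le (hle i))
  have h1 : ∫⁻ y, gridCrossings c x t k y =
      ENNReal.ofReal (∑ l ∈ Finset.range ⌈t * (k + 1)⌉₊, |z (l + 1) - z l|) := by
    unfold gridCrossings
    have hm : ∀ l, Measurable fun y => ((Ico (z l) (z (l + 1))).indicator 1 y +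
        (Ioc (z (l + 1)) (z l)).indicator 1 y : ℝ≥0∞) := fun l =>
      (measurable_one.indicator measurableSet_Ico).add (measurable_one.indicator measurableSet_Ioc)
    rw [lintegral_finsetSum _ fun l _ => hm l,
      ENNReal.ofReal_sum_of_nonneg fun _ _ => abs_nonneg _]
    refine Finset.sum_congr rfl fun l _ => ?_
    rw [lintegral_add_left (measurable_one.indicator measurableSet_Ico),
      lintegral_indicator_one measurableSet_Ico, lintegral_indicator_one measurableSet_Ioc,
      Real.volume_Ico, Real.volume_Ioc]
    rcases le_total (z l) (z (l + 1)) with h | h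
    · rw [abs_of_nonneg (sub_nonneg.2 h), ENNReal.ofReal_of_nonpos (sub_nonpos.2 h), add_zero]
    · rw [abs_of_nonpos (sub_nonpos.2 h), ENNReal.ofReal_of_nonpos (sub_nonpos.2 h), zero_add,
        neg_sub]
  rw [h1, ← ENNReal.ofReal_toReal htop, ← ENNReal.ofReal_add ENNReal.toReal_nonneg (by positivity)]
  refine ENNReal.ofReal_le_ofReal ?_
  have h2 := sum_abs_playPath_le (x := fun i => x (timeGrid t k i)) hc
    (T := fun i => (truncatedVariation c x 0 (timeGrid t k i)).toReal) ENNReal.toReal_nonneg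
    (fun i j hij => ENNReal.toReal_mono (hfin j)
      (truncatedVariation_mono zero_le (timeGrid_mono k hij)))
    (fun i j hij => by
      have := ENNReal.toReal_mono (hfin j) (truncatedVariation_add_le (c := c) (x := x)
        (zero_le (a := timeGrid t k i)) (timeGrid_mono k hij))
      rw [ENNReal.toReal_add (hfin i) ENNReal.ofReal_ne_top] at this
      refine le_trans ?_ this
      gcongr
      rw [ENNReal.toReal_ofReal']
      exact le_max_left _ _) ⌈t * (k + 1)⌉₊
  rwa [timeGrid_ceil_self] at h2

/-- Strict alternating chains are seen by all sufficiently fine grids. -/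
lemma eventually_chain_grid {P Q : ℝ → Prop} (hP : IsOpen {a | P a}) (hQ : IsOpen {a | Q a})
    (hx : ∀ u, ContinuousWithinAt x (Ici u) u) {n : ℕ}
    (h : AlternatingChain (fun u => P (x u)) (fun u => Q (x u)) n 0 t) :
    ∀ᶠ k : ℕ in atTop, AlternatingChain (fun i => P (x (timeGrid t k i)))
      (fun i => Q (x (timeGrid t k i))) n 0 ⌈t * (k + 1)⌉₊ := by
  have := AlternatingChain.eventually_map (l := atTop)
    (f := fun (k : ℕ) (s : ℝ≥0) => ⌈s * (k + 1)⌉₊)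
    (P := fun k i => P (x (timeGrid t k i))) (Q := fun k i => Q (x (timeGrid t k i)))
    (fun k s s' h => Nat.ceil_mono (by gcongr))
    (fun s hs hPs => ((hx s).tendsto.comp (tendsto_timeGrid_ceil hs)).eventually
      (hP.mem_nhds hPs))
    (fun s hs hQs => ((hx s).tendsto.comp (tendsto_timeGrid_ceil hs)).eventually
      (hQ.mem_nhds hQs)) h
  simpa using this

/-- For almost every level the chains are strict, hence visible on fine grids. Being within `c/2` of
the samples, the play path then passes from `≤ y` to `> y`, or from `≥ y` to `< y`; the half-open
intervals in `gridCrossings` count exactly these exits. -/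
lemma ae_numCrossings_le_liminf (hx : ∀ u, ContinuousWithinAt x (Ici u) u) (hc : 0 < c) :
    ∀ᵐ y : ℝ, numCrossings y c x 0 t ≤ liminf (fun k => gridCrossings c x t k y) atTop := by
  -- Upcrossings are downcrossings of `-x` at level `-y`; reflection preserves null sets of levels.
  have hneg : ∀ᵐ y : ℝ, ∀ n : ℕ,
      AlternatingChain (fun u => -y + c / 2 ≤ -x u) (fun v => -x v < -y - c / 2) n 0 t →
      AlternatingChain (fun u => -y + c / 2 < -x u) (fun v => -x v < -y - c / 2) n 0 t :=
    (Measure.measurePreserving_neg (volume : Measure ℝ)).quasiMeasurePreserving.ae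
      (ae_strictChain (x := fun u => -x u) (c := c) (s := 0) (t := t))
  filter_upwards [ae_strictChain (x := x) (c := c) (s := 0) (t := t), hneg] with y hd hu
  rw [numCrossings, numUpcrossings, numDowncrossings_eq hx hc,
    numDowncrossings_eq (x := fun u => -x u) (fun u => (hx u).neg) hc]
  refine ENNReal.biSup_add_biSup_le' ⟨0, .zero zero_le⟩ ⟨0, .zero zero_le⟩ fun m hm n hn => ?_
  have hm' := eventually_chain_grid (P := fun a => -y + c / 2 < -a)
    (Q := fun a => -a < -y - c / 2) (isOpen_lt continuous_const continuous_neg)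
    (isOpen_lt continuous_neg continuous_const) hx (hu m hm)
  have hn' := eventually_chain_grid (P := fun a => y + c / 2 < a)
    (Q := fun a => a < y - c / 2) (isOpen_lt continuous_const continuous_id)
    (isOpen_lt continuous_id continuous_const) hx (hd n hn)
  refine le_liminf_of_le (by isBoundedDefault) ?_
  filter_upwards [hm', hn'] with k hmk hnk
  have hplay := fun i => abs_le.1 (abs_playPath_sub_le (x := fun i => x (timeGrid t k i)) hc i)
  have h1 := hmk.length_le_sum (P := fun i => playPath c (fun i => x (timeGrid t k i)) i ≤ y)
    (fun i hi => by linarith [hplay i]) (fun i hi => not_le.2 (by linarith [hplay i]))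
  have h2 := hnk.length_le_sum (P := fun i => y ≤ playPath c (fun i => x (timeGrid t k i)) i)
    (fun i hi => by linarith [hplay i]) (fun i hi => not_le.2 (by linarith [hplay i]))
  rw [gridCrossings, Finset.sum_add_distrib]
  refine (add_le_add h1 h2).trans (le_of_eq ?_)
  rw [Nat.Ico_zero_eq_range]
  congr 1 <;> refine Finset.sum_congr rfl fun l _ => ?_
  · simp [indicator]
  · simp [indicator, and_comm]

/-- The integral of the numbers of crossings exceeds the truncated variation by at most `c / 2`. -/
lemma lintegral_numCrossings_le (hx : ∀ u, ContinuousWithinAt x (Ici u) u) (hc : 0 < c) :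
    ∫⁻ y, numCrossings y c x 0 t ≤ truncatedVariation c x 0 t + ENNReal.ofReal (c / 2) :=
  calc ∫⁻ y, numCrossings y c x 0 t
      ≤ ∫⁻ y, liminf (fun k => gridCrossings c x t k y) atTop :=
        lintegral_mono_ae (ae_numCrossings_le_liminf hx hc)
    _ ≤ liminf (fun k => ∫⁻ y, gridCrossings c x t k y) atTop :=
        lintegral_liminf_le fun k => measurable_gridCrossings k
    _ ≤ _ := (liminf_le_liminf (Eventually.of_forall fun k =>
        lintegral_gridCrossings_le hc k)).trans (by simp)

end UpperBound

/-! ### Lebesgue measure on the half-line -/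

section LebesgueNonneg

lemma measurableEmbedding_nnreal_coe : MeasurableEmbedding (fun u : ℝ≥0 => (u : ℝ)) :=
  MeasurableEmbedding.subtype_coe measurableSet_Ici

lemma lebesgueNonneg_Ico (a b : ℝ≥0) : lebesgueNonneg (Ico a b) = ((b - a : ℝ≥0) : ℝ≥0∞) := by
  rw [lebesgueNonneg, measurableEmbedding_nnreal_coe.comap_apply]
  have : (fun u : ℝ≥0 => (u : ℝ)) '' Ico a b = Ico (a : ℝ) b := by
    ext r
    constructor
    · rintro ⟨u, ⟨h1, h2⟩, rfl⟩
      exact ⟨by exact_mod_cast h1, by exact_mod_cast h2⟩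
    · rintro ⟨h1, h2⟩
      lift r to ℝ≥0 using a.coe_nonneg.trans h1
      exact ⟨r, ⟨by exact_mod_cast h1, by exact_mod_cast h2⟩, rfl⟩
  rw [this, Real.volume_Ico, ENNReal.ofReal, NNReal.sub_def]

instance noAtoms_lebesgueNonneg : NullSingletonClass lebesgueNonneg where
  measure_singleton a := by
    rw [lebesgueNonneg, measurableEmbedding_nnreal_coe.comap_apply, image_singleton,
      Real.volume_singleton]

end LebesgueNonneg

/-- A right-continuous function has at most countably many discontinuities. -/
lemma countable_not_continuousAt {x : ℝ≥0 → ℝ} (hx : ∀ u, ContinuousWithinAt x (Ici u) u) :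
    {s | ¬ ContinuousAt x s}.Countable := by
  -- Points where the oscillation stays at least `1 / (k + 1)`. Right-continuity at `s` makes the
  -- oscillation small on some `(s, w)`, so each point of `E k` is isolated from the right.
  let E : ℕ → Set ℝ≥0 := fun k =>
    {s | ¬ ∃ U ∈ 𝓝 s, ∀ a ∈ U, ∀ b ∈ U, dist (x a) (x b) < 1 / ((k : ℝ) + 1)}
  have hE : ∀ k, (E k).Countable := by
    intro k
    refine countable_setOfPred_isolated_right_within.mono (?_ : _ ⊆ {s ∈ E k | 𝓝[E k ∩ Ioi s] s = ⊥})
    intro s hs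
    refine ⟨hs, ?_⟩
    have hev : ∀ᶠ a in 𝓝[≥] s, dist (x a) (x s) < 1 / ((k : ℝ) + 1) / 2 :=
      Metric.tendsto_nhds.1 (hx s).tendsto _ (by positivity)
    obtain ⟨w, hw, hwE⟩ := (mem_nhdsGE_iff_exists_Ico_subset).1 hev
    have hsw : s < w := hw
    rw [← Filter.empty_mem_iff_bot, inter_comm, nhdsWithin_inter']
    filter_upwards [mem_inf_of_left (Ioo_mem_nhdsGT hsw),
      mem_inf_of_right (mem_principal_self _)] with r hr hrE
    refine hrE ⟨Ioo s w, Ioo_mem_nhds hr.1 hr.2, fun a ha b hb => ?_⟩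
    have h1 : dist (x a) (x s) < 1 / ((k : ℝ) + 1) / 2 := hwE ⟨ha.1.le, ha.2⟩
    have h2 : dist (x b) (x s) < 1 / ((k : ℝ) + 1) / 2 := hwE ⟨hb.1.le, hb.2⟩
    linarith [dist_triangle_right (x a) (x b) (x s)]
  refine (countable_iUnion hE).mono fun s hs => ?_
  by_contra hcon
  refine hs (Metric.tendsto_nhds.2 fun ε hε => ?_)
  obtain ⟨k, hk⟩ := exists_nat_one_div_lt hε
  obtain ⟨U, hU, h⟩ := not_not.1 fun h => hcon (mem_iUnion.2 ⟨k, h⟩)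
  filter_upwards [hU] with a ha
  exact (h a ha s (mem_of_mem_nhds hU)).trans hk

/-! ### Lower bound for integrals of continuous functions -/

section LowerBound

/-- The infimum of `f` over the convex hull of the range of `x` on `[a, b]`. -/
noncomputable def cellInf (f : ℝ → ℝ≥0∞) (x : ℝ≥0 → ℝ) (a b : ℝ≥0) : ℝ≥0∞ :=
  ⨅ (y : ℝ) (_ : ∃ u ∈ Icc a b, ∃ v ∈ Icc a b, x u ≤ y ∧ y ≤ x v), f y

variable {f : ℝ → ℝ≥0∞} {x : ℝ≥0 → ℝ} {c : ℝ} {t : ℝ≥0}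

lemma cellInf_le {a b : ℝ≥0} (hab : a ≤ b) : cellInf f x a b ≤ f (x a) :=
  iInf₂_le _ ⟨a, left_mem_Icc.2 hab, a, left_mem_Icc.2 hab, le_rfl, le_rfl⟩

lemma cellInf_mul_lintegral_le (hx : ∀ u, ContinuousWithinAt x (Ici u) u) (hc : 0 < c)
    (a b : ℝ≥0) :
    cellInf f x a b * ∫⁻ y, numCrossings y c x a b ≤ ∫⁻ y, f y * numCrossings y c x a b := by
  refine (lintegral_const_mul_le _ _).trans (lintegral_mono fun y => ?_)
  by_cases h : numCrossings y c x a b = 0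
  · simp [h]
  · dsimp only
    gcongr
    exact iInf₂_le y (exists_of_numCrossings_ne_zero hx hc h)

lemma sum_cellInf_mul_truncatedVariation_le (hx : ∀ u, ContinuousWithinAt x (Ici u) u)
    (hc : 0 < c) (hf : Measurable f) {u : ℕ → ℝ≥0} (hu : Monotone u) (n : ℕ) :
    ∑ i ∈ Finset.range n,
        cellInf f x (u i) (u (i + 1)) * truncatedVariation c x (u i) (u (i + 1)) ≤
      ∫⁻ y, f y * numCrossings y c x (u 0) (u n) :=
  calc ∑ i ∈ Finset.range n,
        cellInf f x (u i) (u (i + 1)) * truncatedVariation c x (u i) (u (i + 1))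
      ≤ ∑ i ∈ Finset.range n, ∫⁻ y, f y * numCrossings y c x (u i) (u (i + 1)) := by
        refine Finset.sum_le_sum fun i _ => ?_
        refine le_trans ?_ (cellInf_mul_lintegral_le hx hc _ _)
        gcongr
        exact truncatedVariation_le_lintegral hx hc
    _ = ∫⁻ y, ∑ i ∈ Finset.range n, f y * numCrossings y c x (u i) (u (i + 1)) :=
        (lintegral_finsetSum _ fun i _ => hf.mul (measurable_numCrossings hx hc)).symm
    _ ≤ _ := by
        refine lintegral_mono fun y => ?_
        rw [← Finset.mul_sum]
        gcongr
        exact sum_numCrossings_le hx hc hu n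

lemma lintegral_Ico_le_sum {α : Type*} [MeasurableSpace α] [LinearOrder α] (μ : Measure α)
    (f : α → ℝ≥0∞) {u : ℕ → α} (hu : Monotone u) (n : ℕ) :
    ∫⁻ s in Ico (u 0) (u n), f s ∂μ ≤ ∑ i ∈ Finset.range n, ∫⁻ s in Ico (u i) (u (i + 1)), f s ∂μ := by
  induction n with
  | zero => simp
  | succ n ih =>
    rw [← Ico_union_Ico_eq_Ico (hu n.zero_le) (hu n.le_succ), Finset.sum_range_succ]
    exact (lintegral_union_le _ _ _).trans (add_le_add_left ih _)

/-- Lower Darboux sums of `f ∘ x` on the grids. -/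
lemma lintegral_comp_le_liminf (hx : ∀ u, ContinuousWithinAt x (Ici u) u) (hf : Continuous f) :
    ∫⁻ s in Ico 0 t, f (x s) ∂lebesgueNonneg ≤
      liminf (fun k : ℕ => ∑ i ∈ Finset.range ⌈t * (k + 1)⌉₊,
        cellInf f x (timeGrid t k i) (timeGrid t k (i + 1)) *
          ((timeGrid t k (i + 1) - timeGrid t k i : ℝ≥0) : ℝ≥0∞)) atTop := by
  -- The step function whose value at `s` is the infimum for the cell containing `s`; its integral
  -- is bounded by the Darboux sum.
  set φ : ℕ → ℝ≥0 → ℝ≥0∞ := fun k s => cellInf f x (timeGrid t k ⌊s * (k + 1)⌋₊)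
    (timeGrid t k (⌊s * (k + 1)⌋₊ + 1)) with hφ
  have hφm : ∀ k, Measurable (φ k) := fun k =>
    (measurable_from_nat (f := fun i => cellInf f x (timeGrid t k i) (timeGrid t k (i + 1)))).comp
      (Nat.measurable_floor.comp (measurable_id.mul_const _))
  have hfloor : ∀ (k : ℕ) (s : ℝ≥0), s < t → ∀ i : ℕ,
      s ∈ Ico (timeGrid t k i) (timeGrid t k (i + 1)) → ⌊s * (k + 1)⌋₊ = i := by
    intro k s hst i hs
    rw [Nat.floor_eq_iff zero_le]
    have h1 : (i : ℝ≥0) / (k + 1) ≤ s := (min_le_iff.1 hs.1).resolve_right (not_le.2 hst)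
    have h2 : s < ((i + 1 : ℕ) : ℝ≥0) / (k + 1) := (lt_min_iff.1 hs.2).1
    rw [div_le_iff₀ (by positivity)] at h1
    rw [lt_div_iff₀ (by positivity)] at h2
    exact ⟨h1, by exact_mod_cast h2⟩
  have hle : ∀ k, ∫⁻ s in Ico 0 t, φ k s ∂lebesgueNonneg ≤
      ∑ i ∈ Finset.range ⌈t * (k + 1)⌉₊,
        cellInf f x (timeGrid t k i) (timeGrid t k (i + 1)) *
          ((timeGrid t k (i + 1) - timeGrid t k i : ℝ≥0) : ℝ≥0∞) := by
    intro k
    have := lintegral_Ico_le_sum lebesgueNonneg (φ k) (timeGrid_mono (t := t) k) ⌈t * (k + 1)⌉₊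
    rw [timeGrid_zero, timeGrid_ceil_self] at this
    refine this.trans (Finset.sum_le_sum fun i _ => ?_)
    rw [← lebesgueNonneg_Ico, ← setLIntegral_const]
    refine setLIntegral_mono measurable_const fun s hs => ?_
    simp only [hφ, hfloor k s (hs.2.trans_le (min_le_right _ _)) i hs, le_rfl]
  -- At a continuity point the values on the shrinking cell fall in a small ball around `x s`; a
  -- real ball is an interval, so it contains their convex hull too.
  have hcont : ∀ᵐ s ∂(lebesgueNonneg.restrict (Ico 0 t)),
      f (x s) ≤ liminf (fun k => φ k s) atTop := by
    filter_upwards [ae_restrict_of_ae ((countable_not_continuousAt hx).ae_notMem lebesgueNonneg),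
      ae_restrict_mem measurableSet_Ico] with s hs hst
    have hs' : ContinuousAt x s := not_not.1 hs
    refine le_of_forall_lt fun r hr => ?_
    obtain ⟨r', hr', hr''⟩ := exists_between hr
    refine hr'.trans_le (le_liminf_of_le (by isBoundedDefault) ?_)
    obtain ⟨ε, hε, hball⟩ := Metric.mem_nhds_iff.1
      (hf.continuousAt.eventually_const_lt hr'' : ∀ᶠ y in 𝓝 (x s), r' < f y)
    obtain ⟨δ, hδ, hball'⟩ := Metric.mem_nhds_iff.1 (hs' (Metric.ball_mem_nhds _ hε))
    obtain ⟨k₀, hk₀⟩ := exists_nat_one_div_lt hδ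
    filter_upwards [eventually_ge_atTop k₀] with k hk
    have hcell : ∀ u ∈ Icc (timeGrid t k ⌊s * (k + 1)⌋₊) (timeGrid t k (⌊s * (k + 1)⌋₊ + 1)),
        x u ∈ Metric.ball (x s) ε := by
      intro u hu
      refine hball' ?_
      have hpos : (0 : ℝ) < (k : ℝ) + 1 := by positivity
      have h1 : ((⌊s * (k + 1)⌋₊ : ℝ≥0) : ℝ) ≤ s * (k + 1) := by
        exact_mod_cast Nat.floor_le (zero_le (a := s * ((k : ℝ≥0) + 1)))
      have h2 : (s : ℝ) * (k + 1) < (⌊s * (k + 1)⌋₊ : ℝ≥0) + 1 := by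
        exact_mod_cast Nat.lt_floor_add_one (s * ((k : ℝ≥0) + 1))
      have h3 : (u : ℝ) ≤ ((⌊s * (k + 1)⌋₊ : ℝ≥0) + 1) / (k + 1) := by
        have := hu.2.trans (min_le_left _ _)
        exact_mod_cast this
      have h4 : ((⌊s * (k + 1)⌋₊ : ℝ≥0) : ℝ) / (k + 1) ≤ u := by
        have h5 : (⌊s * ((k : ℝ≥0) + 1)⌋₊ : ℝ≥0) / (k + 1) ≤ s :=
          (div_le_iff₀ (by positivity)).2 (Nat.floor_le zero_le)
        have := hu.1
        rw [timeGrid, min_eq_left (h5.trans hst.2.le)] at this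
        exact_mod_cast this
      rw [le_div_iff₀ hpos] at h3
      rw [div_le_iff₀ hpos] at h4
      have h6 : |(u : ℝ) - s| * (k + 1) ≤ 1 := by
        rw [show |(u : ℝ) - s| * (k + 1) = |((u : ℝ) - s) * (k + 1)| by
          rw [abs_mul, abs_of_pos hpos], abs_le]
        constructor <;> linarith
      rw [Metric.mem_ball, NNReal.dist_eq]
      refine lt_of_le_of_lt ?_ hk₀
      have h7 : |(u : ℝ) - s| ≤ 1 / ((k : ℝ) + 1) := (le_div_iff₀ hpos).2 h6
      refine h7.trans ?_
      gcongr
    refine le_iInf₂ fun y hy => ?_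
    obtain ⟨u, hu, v, hv, h1, h2⟩ := hy
    have hu' := hcell u hu
    have hv' := hcell v hv
    rw [Real.ball_eq_Ioo] at hu' hv' hball
    exact (hball ⟨hu'.1.trans_le h1, h2.trans_lt hv'.2⟩ : r' < f y).le
  calc ∫⁻ s in Ico 0 t, f (x s) ∂lebesgueNonneg
      ≤ ∫⁻ s in Ico 0 t, liminf (fun k => φ k s) atTop ∂lebesgueNonneg := lintegral_mono_ae hcont
    _ ≤ liminf (fun k => ∫⁻ s in Ico 0 t, φ k s ∂lebesgueNonneg) atTop :=
        lintegral_liminf_le hφm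
    _ ≤ _ := liminf_le_liminf (Eventually.of_forall hle)

/-- The product is `c ^ (1 / β)`; this makes every error of order `c` negligible after
normalization. -/
lemma tendsto_ofReal_rpow_mul {β : ℝ} (hβ : 0 < β) :
    Tendsto (fun c : ℝ => ENNReal.ofReal (c ^ (1 / β - 1)) * ENNReal.ofReal c) (𝓝[>] 0) (𝓝 0) := by
  have h1 : Tendsto (fun c : ℝ => ENNReal.ofReal (c ^ (1 / β))) (𝓝[>] 0) (𝓝 0) := by
    have h2 : Tendsto (fun c : ℝ => c ^ (1 / β)) (𝓝[>] 0) (𝓝 0) := by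
      have := (Real.continuousAt_rpow_const 0 (1 / β) (Or.inr (by positivity))).tendsto
      rw [Real.zero_rpow (by positivity)] at this
      exact this.mono_left nhdsWithin_le_nhds
    simpa using ENNReal.tendsto_ofReal h2
  refine h1.congr' ?_
  filter_upwards [self_mem_nhdsWithin] with c hc
  have hc : 0 < c := hc
  rw [← ENNReal.ofReal_mul (by positivity)]
  congr 1
  rw [← Real.rpow_add_one hc.ne', sub_add_cancel]

variable {β : ℝ} {C : ℝ≥0}

/-- The truncated variation of a cell is at least the difference of those from `0` to its endpoints,
minus `c`. For a fixed partition, the normalized differences converge to `C` times the cell lengths.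
-/
lemma sum_cellInf_le_liminf (hβ : 0 < β) (hx : ∀ u, ContinuousWithinAt x (Ici u) u)
    (hTV : ∀ t : ℝ≥0, Tendsto (fun c : ℝ => ENNReal.ofReal (c ^ (1 / β - 1)) *
      truncatedVariation c x 0 t) (𝓝[>] 0) (𝓝 ((C : ℝ≥0∞) * (t : ℝ≥0∞))))
    (hf : Measurable f) (hf' : ∀ y, f y ≠ ⊤) {u : ℕ → ℝ≥0} (hu : Monotone u) (h0 : u 0 = 0)
    (n : ℕ) :
    C * ∑ i ∈ Finset.range n, cellInf f x (u i) (u (i + 1)) * ((u (i + 1) - u i : ℝ≥0) : ℝ≥0∞) ≤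
      liminf (fun c : ℝ => ENNReal.ofReal (c ^ (1 / β - 1)) *
        ∫⁻ y, f y * numCrossings y c x 0 (u n)) (𝓝[>] 0) := by
  have hlim : Tendsto (fun c : ℝ => ∑ i ∈ Finset.range n, cellInf f x (u i) (u (i + 1)) *
      (ENNReal.ofReal (c ^ (1 / β - 1)) * truncatedVariation c x 0 (u (i + 1)) -
        ENNReal.ofReal (c ^ (1 / β - 1)) * truncatedVariation c x 0 (u i) -
        ENNReal.ofReal (c ^ (1 / β - 1)) * ENNReal.ofReal c)) (𝓝[>] 0)
      (𝓝 (∑ i ∈ Finset.range n, cellInf f x (u i) (u (i + 1)) *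
        (C * u (i + 1) - C * u i - 0))) := by
    refine tendsto_finsetSum _ fun i _ => ?_
    refine ENNReal.Tendsto.const_mul ?_
      (Or.inr (ne_top_of_le_ne_top (hf' _) (cellInf_le (hu i.le_succ))))
    refine ENNReal.Tendsto.sub (ENNReal.Tendsto.sub (hTV _) (hTV _) ?_)
      (tendsto_ofReal_rpow_mul hβ) (Or.inr ENNReal.zero_ne_top)
    exact Or.inr (ENNReal.mul_ne_top ENNReal.coe_ne_top ENNReal.coe_ne_top)
  have heq : C * ∑ i ∈ Finset.range n,
      cellInf f x (u i) (u (i + 1)) * ((u (i + 1) - u i : ℝ≥0) : ℝ≥0∞) =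
      ∑ i ∈ Finset.range n, cellInf f x (u i) (u (i + 1)) * (C * u (i + 1) - C * u i - 0) := by
    rw [Finset.mul_sum]
    refine Finset.sum_congr rfl fun i _ => ?_
    rw [tsub_zero, ← ENNReal.mul_sub (fun _ _ => ENNReal.coe_ne_top), ENNReal.coe_sub]
    ring
  rw [heq, ← hlim.liminf_eq]
  refine liminf_le_liminf ?_
  filter_upwards [self_mem_nhdsWithin] with c hc
  have hc : 0 < c := hc
  have := sum_cellInf_mul_truncatedVariation_le hx hc hf hu n
  rw [h0] at this
  refine le_trans ?_ (mul_le_mul_right this _)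
  rw [Finset.mul_sum]
  refine Finset.sum_le_sum fun i _ => ?_
  rw [mul_left_comm]
  gcongr
  rw [tsub_le_iff_right, tsub_le_iff_left, ← add_assoc, ← mul_add, ← mul_add]
  gcongr
  exact truncatedVariation_le_add hc.le zero_le (hu i.le_succ)

/-- Lower bound for the normalized integrals of a continuous function against the numbers of
crossings. -/
lemma mul_lintegral_le_liminf (hβ : 0 < β) (hx : ∀ u, ContinuousWithinAt x (Ici u) u)
    (hTV : ∀ t : ℝ≥0, Tendsto (fun c : ℝ => ENNReal.ofReal (c ^ (1 / β - 1)) *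
      truncatedVariation c x 0 t) (𝓝[>] 0) (𝓝 ((C : ℝ≥0∞) * (t : ℝ≥0∞))))
    (hf : Continuous f) (hf' : ∀ y, f y ≠ ⊤) (t : ℝ≥0) :
    C * ∫⁻ s in Icc 0 t, f (x s) ∂lebesgueNonneg ≤
      liminf (fun c : ℝ => ENNReal.ofReal (c ^ (1 / β - 1)) *
        ∫⁻ y, f y * numCrossings y c x 0 t) (𝓝[>] 0) := by
  rw [setLIntegral_congr Ico_ae_eq_Icc.symm]
  rcases eq_or_ne C 0 with rfl | hC
  · simp
  -- Dividing by `C` isolates the liminf over grids, so each grid can be bounded separately.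
  rw [mul_comm, ← ENNReal.le_div_iff_mul_le (Or.inl (by simpa using hC))
    (Or.inl ENNReal.coe_ne_top)]
  refine (lintegral_comp_le_liminf hx hf).trans (liminf_le_of_frequently_le' ?_)
  refine Frequently.of_forall fun k => ?_
  rw [ENNReal.le_div_iff_mul_le (Or.inl (by simpa using hC)) (Or.inl ENNReal.coe_ne_top), mul_comm]
  have := sum_cellInf_le_liminf hβ hx hTV hf.measurable hf' (timeGrid_mono (t := t) k)
    (timeGrid_zero k) ⌈t * (k + 1)⌉₊
  rwa [timeGrid_ceil_self] at this

end LowerBound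

/-! ### A criterion for weak convergence -/

section WeakConvergence

/-- Convergence of the total masses and lower semicontinuity on nonnegative continuous functions
imply weak convergence. -/
lemma tendstoWeakly_of_le_liminf {ι : Type*} {μ : ι → Measure ℝ} {l : Filter ι} {ν : Measure ℝ}
    [IsFiniteMeasure ν] (hmass : Tendsto (fun i => μ i univ) l (𝓝 (ν univ)))
    (h : ∀ f : ℝ → ℝ≥0∞, Continuous f → (∀ y, f y ≠ ⊤) →
      ∫⁻ y, f y ∂ν ≤ liminf (fun i => ∫⁻ y, f y ∂(μ i)) l) :
    TendstoWeakly μ l ν := by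
  have hfin : ∀ᶠ i in l, IsFiniteMeasure (μ i) :=
    (hmass.eventually_lt_const (measure_lt_top ν univ)).mono fun i hi => ⟨hi⟩
  have key : ∀ (f : ℝ → ℝ≥0∞) (K : ℝ≥0), Continuous f → (∀ y, f y ≤ K) →
      Tendsto (fun i => ∫⁻ y, f y ∂(μ i)) l (𝓝 (∫⁻ y, f y ∂ν)) := by
    intro f K hf hfK
    have hg : Continuous fun y => (K : ℝ≥0∞) - f y :=
      ENNReal.continuous_sub_left ENNReal.coe_ne_top |>.comp hf
    have hadd : ∀ m : Measure ℝ, ∫⁻ y, f y ∂m + ∫⁻ y, K - f y ∂m = K * m univ := by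
      intro m
      rw [← lintegral_add_left hf.measurable, ← lintegral_const]
      exact lintegral_congr fun y => add_tsub_cancel_of_le (hfK y)
    -- Along an ultrafilter both integrals have limits in the compact space `ℝ≥0∞`. Each limit is at
    -- least its target, and the finite sum is fixed by the mass, so both are equalities.
    rw [tendsto_iff_ultrafilter]
    intro U hU
    obtain ⟨α, hα⟩ : ∃ α, Tendsto (fun i => ∫⁻ y, f y ∂(μ i)) U (𝓝 α) :=
      ⟨_, (U.map fun i => ∫⁻ y, f y ∂(μ i)).le_nhds_lim⟩
    obtain ⟨γ, hγ⟩ : ∃ γ, Tendsto (fun i => ∫⁻ y, K - f y ∂(μ i)) U (𝓝 γ) :=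
      ⟨_, (U.map fun i => ∫⁻ y, K - f y ∂(μ i)).le_nhds_lim⟩
    have h1 : ∫⁻ y, f y ∂ν ≤ α := by
      rw [← hα.liminf_eq]
      exact (h f hf fun y => ne_top_of_le_ne_top ENNReal.coe_ne_top (hfK y)).trans
        (liminf_le_liminf_of_le hU)
    have h2 : ∫⁻ y, K - f y ∂ν ≤ γ := by
      rw [← hγ.liminf_eq]
      exact (h _ hg fun y => ne_top_of_le_ne_top ENNReal.coe_ne_top tsub_le_self).trans
        (liminf_le_liminf_of_le hU)
    have h3 : α + γ = ∫⁻ y, f y ∂ν + ∫⁻ y, K - f y ∂ν := by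
      rw [hadd ν]
      refine tendsto_nhds_unique (hα.add hγ) ?_
      simp only [hadd]
      exact ENNReal.Tendsto.const_mul (hmass.mono_left hU) (Or.inr ENNReal.coe_ne_top)
    have h4 : α + γ ≠ ⊤ := by
      rw [h3, hadd ν]
      exact ENNReal.mul_ne_top ENNReal.coe_ne_top (measure_ne_top ν univ)
    have h5 : α = ∫⁻ y, f y ∂ν := by
      refine le_antisymm ?_ h1
      have h6 : α + γ ≤ ∫⁻ y, f y ∂ν + γ := h3.le.trans (add_le_add_right h2 _)
      exact (ENNReal.add_le_add_iff_right (ne_top_of_le_ne_top h4 le_add_self)).1 h6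
    rwa [← h5]
  refine ⟨hfin, inferInstance, fun g => ?_⟩
  -- Adding the norm makes `g` nonnegative; the added constant is handled by convergence of masses.
  have hpos : ∀ y, 0 ≤ g y + ‖g‖ := fun y => by
    linarith [(abs_le.1 (g.norm_coe_le_norm y)).1]
  have hle : ∀ y, g y + ‖g‖ ≤ 2 * ‖g‖ := fun y => by
    linarith [(abs_le.1 (g.norm_coe_le_norm y)).2]
  have hint : ∀ m : Measure ℝ, IsFiniteMeasure m → ∫ y, g y ∂m =
      (∫⁻ y, ENNReal.ofReal (g y + ‖g‖) ∂m).toReal - ‖g‖ * (m univ).toReal := by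
    intro m hm
    rw [← integral_eq_lintegral_of_nonneg_ae (Eventually.of_forall hpos)
      (g.continuous.add continuous_const).aestronglyMeasurable,
      integral_add (g.integrable m) (integrable_const _), integral_const, smul_eq_mul,
      Measure.real]
    ring
  have hlim := key (fun y => ENNReal.ofReal (g y + ‖g‖)) (2 * ‖g‖).toNNReal
    (ENNReal.continuous_ofReal.comp (g.continuous.add continuous_const))
    (fun y => ENNReal.ofReal_le_ofReal (hle y))
  have hne : ∫⁻ y, ENNReal.ofReal (g y + ‖g‖) ∂ν ≠ ⊤ := by
    refine ne_top_of_le_ne_top ?_ (lintegral_mono (g := fun _ => ENNReal.ofReal (2 * ‖g‖))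
      fun y => ENNReal.ofReal_le_ofReal (hle y))
    rw [lintegral_const]
    exact ENNReal.mul_ne_top ENNReal.ofReal_ne_top (measure_ne_top ν univ)
  rw [hint ν inferInstance]
  refine (((ENNReal.tendsto_toReal hne).comp hlim).sub
    (((ENNReal.tendsto_toReal (measure_ne_top ν univ)).comp hmass).const_mul ‖g‖)).congr' ?_
  filter_upwards [hfin] with i hi
  exact (hint (μ i) hi).symm

end WeakConvergence

/-! ### The deterministic theorem and the passage to all times -/

section Path

variable {x : ℝ≥0 → ℝ} {β : ℝ} {C : ℝ≥0}

lemma lebesgueNonneg_Icc_zero (t : ℝ≥0) : lebesgueNonneg (Icc 0 t) = t := by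
  rw [← measure_congr Ico_ae_eq_Icc, lebesgueNonneg_Ico, tsub_zero]

lemma tendsto_lintegral_numCrossings (hβ : 0 < β) (hx : ∀ u, ContinuousWithinAt x (Ici u) u)
    {t : ℝ≥0} (hTV : Tendsto (fun c : ℝ => ENNReal.ofReal (c ^ (1 / β - 1)) *
      truncatedVariation c x 0 t) (𝓝[>] 0) (𝓝 ((C : ℝ≥0∞) * (t : ℝ≥0∞)))) :
    Tendsto (fun c : ℝ => ENNReal.ofReal (c ^ (1 / β - 1)) * ∫⁻ y, numCrossings y c x 0 t)
      (𝓝[>] 0) (𝓝 ((C : ℝ≥0∞) * (t : ℝ≥0∞))) := by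
  have h := hTV.add (tendsto_ofReal_rpow_mul hβ)
  rw [add_zero] at h
  refine tendsto_of_tendsto_of_tendsto_of_le_of_le' hTV h ?_ ?_
  · filter_upwards [self_mem_nhdsWithin] with c hc
    gcongr
    exact truncatedVariation_le_lintegral hx hc
  · filter_upwards [self_mem_nhdsWithin] with c hc
    have hc : 0 < c := hc
    rw [← mul_add]
    gcongr
    refine (lintegral_numCrossings_le hx hc).trans ?_
    gcongr
    linarith

theorem tendstoWeakly_numCrossings (hβ : 0 < β) (hx : ∀ u, ContinuousWithinAt x (Ici u) u)
    (hxm : Measurable x)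
    (hTV : ∀ t : ℝ≥0, Tendsto (fun c : ℝ => ENNReal.ofReal (c ^ (1 / β - 1)) *
      truncatedVariation c x 0 t) (𝓝[>] 0) (𝓝 ((C : ℝ≥0∞) * (t : ℝ≥0∞))))
    {t : ℝ≥0} (hac : occupationMeasure x lebesgueNonneg t ≪ (volume : Measure ℝ)) :
    TendstoWeakly
      (fun c : ℝ => (volume : Measure ℝ).withDensity (fun y =>
        ENNReal.ofReal (c ^ (1 / β - 1)) * numCrossings y c x 0 t)) (𝓝[>] 0)
      ((volume : Measure ℝ).withDensity (fun y =>
        (C : ℝ≥0∞) * localTime x volume lebesgueNonneg t y)) := by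
  have hmass : occupationMeasure x lebesgueNonneg t univ = t := by
    rw [occupationMeasure, Measure.map_apply hxm MeasurableSet.univ, preimage_univ,
      Measure.restrict_apply_univ, lebesgueNonneg_Icc_zero]
  have : IsFiniteMeasure (occupationMeasure x lebesgueNonneg t) :=
    ⟨by rw [hmass]; exact ENNReal.coe_lt_top⟩
  -- The only use of absolute continuity: the limit is `C` times the occupation measure.
  have hν : (volume : Measure ℝ).withDensity (fun y =>
      (C : ℝ≥0∞) * localTime x volume lebesgueNonneg t y) =
      (C : ℝ≥0∞) • occupationMeasure x lebesgueNonneg t := by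
    rw [← Measure.withDensity_rnDeriv_eq _ _ hac,
      ← withDensity_smul _ (Measure.measurable_rnDeriv _ _)]
    rfl
  have hμ : ∀ c : ℝ, 0 < c → ∀ f : ℝ → ℝ≥0∞, Measurable f →
      ∫⁻ y, f y ∂((volume : Measure ℝ).withDensity (fun y =>
        ENNReal.ofReal (c ^ (1 / β - 1)) * numCrossings y c x 0 t)) =
      ENNReal.ofReal (c ^ (1 / β - 1)) * ∫⁻ y, f y * numCrossings y c x 0 t := by
    intro c hc f hf
    have hn := measurable_numCrossings (s := 0) (t := t) hx hc
    rw [lintegral_withDensity_eq_lintegral_mul _ (hn.const_mul _) hf]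
    refine Eq.trans (lintegral_congr fun y => ?_) (lintegral_const_mul _ (hf.mul hn))
    simp only [Pi.mul_apply]
    ring
  rw [hν]
  have : IsFiniteMeasure ((C : ℝ≥0∞) • occupationMeasure x lebesgueNonneg t) :=
    Measure.smul_finite _ ENNReal.coe_ne_top
  refine tendstoWeakly_of_le_liminf ?_ fun f hf hf' => ?_
  · rw [Measure.smul_apply, smul_eq_mul, hmass]
    refine (tendsto_lintegral_numCrossings hβ hx (hTV t)).congr' ?_
    filter_upwards [self_mem_nhdsWithin] with c hc
    have := hμ c hc (fun _ => 1) measurable_const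
    simpa using this.symm
  · rw [lintegral_smul_measure, smul_eq_mul, occupationMeasure, lintegral_map hf.measurable hxm]
    refine (mul_lintegral_le_liminf hβ hx hTV hf hf' t).trans (le_of_eq (liminf_congr ?_))
    filter_upwards [self_mem_nhdsWithin] with c hc
    exact (hμ c hc f hf.measurable).symm

/-- By monotonicity in time, the asymptotics of the truncated variation extend from a dense set of
times, containing `0`, to all times. -/
lemma tendsto_truncatedVariation_of_dense {S : Set ℝ≥0} (hS : Dense S) (h0 : 0 ∈ S)
    (hTV : ∀ t ∈ S, Tendsto (fun c : ℝ => ENNReal.ofReal (c ^ (1 / β - 1)) *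
      truncatedVariation c x 0 t) (𝓝[>] 0) (𝓝 ((C : ℝ≥0∞) * (t : ℝ≥0∞)))) (t : ℝ≥0) :
    Tendsto (fun c : ℝ => ENNReal.ofReal (c ^ (1 / β - 1)) *
      truncatedVariation c x 0 t) (𝓝[>] 0) (𝓝 ((C : ℝ≥0∞) * (t : ℝ≥0∞))) := by
  rcases eq_or_ne t 0 with rfl | ht
  · exact hTV 0 h0
  have hcont : Continuous fun q : ℝ≥0 => (C : ℝ≥0∞) * (q : ℝ≥0∞) := by
    simp only [← ENNReal.coe_mul]
    exact ENNReal.continuous_coe.comp (continuous_const.mul continuous_id)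
  rw [tendsto_order]
  constructor
  · intro a ha
    obtain ⟨w, hw, hwt⟩ := exists_Ioc_subset_of_mem_nhds
      (hcont.continuousAt.eventually_const_lt ha) ⟨0, pos_iff_ne_zero.2 ht⟩
    obtain ⟨q, hq, hwq, hqt⟩ := hS.exists_between hw
    filter_upwards [(hTV q hq).eventually_const_lt (hwt ⟨hwq, hqt.le⟩ : a < C * q)] with c hc
    refine hc.trans_le ?_
    gcongr
    exact truncatedVariation_mono zero_le hqt.le
  · intro b hb
    obtain ⟨w, hw, hwt⟩ := exists_Ico_subset_of_mem_nhds
      (hcont.continuousAt.eventually_lt_const hb) ⟨t + 1, lt_add_one t⟩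
    obtain ⟨q, hq, htq, hqw⟩ := hS.exists_between hw
    filter_upwards [(hTV q hq).eventually_lt_const (hwt ⟨htq.le, hqw⟩ : C * q < b)] with c hc
    refine lt_of_le_of_lt ?_ hc
    gcongr
    exact truncatedVariation_mono zero_le htq.le

lemma occupationMeasure_mono (hxm : Measurable x) (ξ : Measure ℝ≥0) {s t : ℝ≥0} (hst : s ≤ t) :
    occupationMeasure x ξ s ≤ occupationMeasure x ξ t :=
  Measure.map_mono (Measure.restrict_mono (Icc_subset_Icc_right hst) le_rfl) hxm

end Path

theorem corollary1 {Ω : Type*} [MeasurableSpace Ω] (P : Measure Ω) [IsProbabilityMeasure P]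
    (X : ℝ≥0 → Ω → ℝ) (β : ℝ) (hβ : 0 < β) (C : ℝ≥0)
    (hcadlag : ∀ᵐ ω ∂P, IsCadlag (fun s => X s ω))
    (hTV : ∀ t : ℝ≥0, ∀ᵐ ω ∂P,
      Tendsto (fun c : ℝ => ENNReal.ofReal (c ^ (1 / β - 1)) *
          truncatedVariation c (fun s => X s ω) 0 t)
        (𝓝[>] 0) (𝓝 ((C : ℝ≥0∞) * (t : ℝ≥0∞))))
    (hL : PossessesLocalTime P X (volume : Measure ℝ) (fun _ => lebesgueNonneg)) :
    ∃ ΩX : Set Ω, MeasurableSet ΩX ∧ P ΩX = 1 ∧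
      ∀ ω ∈ ΩX, ∀ t : ℝ≥0,
        occupationMeasure (fun s => X s ω) lebesgueNonneg t ≪ (volume : Measure ℝ) ∧
        (∀ c : ℝ, 0 < c → Measurable (fun y : ℝ => numCrossings y c (fun s => X s ω) 0 t)) ∧
        TendstoWeakly
          (fun c : ℝ => (volume : Measure ℝ).withDensity (fun y =>
            ENNReal.ofReal (c ^ (1 / β - 1)) * numCrossings y c (fun s => X s ω) 0 t))
          (𝓝[>] 0)
          ((volume : Measure ℝ).withDensity (fun y =>
            (C : ℝ≥0∞) * localTime (fun s => X s ω) volume lebesgueNonneg t y)) := by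
  obtain ⟨S, hSc, hSd⟩ := TopologicalSpace.exists_countable_dense ℝ≥0
  have hgood : ∀ᵐ ω ∂P, IsCadlag (fun s => X s ω) ∧
      (∀ t ∈ insert 0 S, Tendsto (fun c : ℝ => ENNReal.ofReal (c ^ (1 / β - 1)) *
          truncatedVariation c (fun s => X s ω) 0 t)
        (𝓝[>] 0) (𝓝 ((C : ℝ≥0∞) * (t : ℝ≥0∞)))) ∧
      -- Integer times suffice, because the occupation measure increases with time.
      ∀ n : ℕ, occupationMeasure (fun s => X s ω) lebesgueNonneg n ≪ (volume : Measure ℝ) := by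
    filter_upwards [hcadlag, (ae_ball_iff (hSc.insert 0)).2 fun t _ => hTV t,
      ae_all_iff.2 fun n : ℕ => hL.2 n] with ω h1 h2 h3
    exact ⟨h1, h2, h3⟩
  obtain ⟨A, hA, hAm, hA0⟩ := exists_measurable_superset_of_null (ae_iff.1 hgood)
  refine ⟨Aᶜ, hAm.compl, by rw [prob_compl_eq_one_iff hAm, hA0], fun ω hω t => ?_⟩
  obtain ⟨h1, h2, h3⟩ := not_not.1 fun h => hω (hA h)
  have hxm : Measurable fun s => X s ω := hL.1.comp measurable_prodMk_right
  obtain ⟨n, hn⟩ := exists_nat_ge t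
  have hac : occupationMeasure (fun s => X s ω) lebesgueNonneg t ≪ (volume : Measure ℝ) :=
    (occupationMeasure_mono hxm lebesgueNonneg hn).absolutelyContinuous.trans (h3 n)
  exact ⟨hac, fun c hc => measurable_numCrossings h1.1 hc, tendstoWeakly_numCrossings hβ h1.1 hxm
    (tendsto_truncatedVariation_of_dense (hSd.mono (subset_insert 0 S)) (mem_insert 0 S) h2) hac⟩
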